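/- Let $\alpha\in(0,1)$, $1<p<q<\infty$ and $\frac1p-\frac1q=\alpha$. There is a constant $C$ depending only on $\alpha,p,q$ such that the following holds. Let $(\Omega,\Sigma,P)$ be a probability space with a filtration $\mathcal F=\{\mathcal F_n\}_{n\ge 0}$ such that each $\sigma$-algebra $\mathcal F_n$ is generated by at most countably many atoms (no regularity of the filtration is assumed). Let $b_n(x)$ be the probability of the atom of $\mathcal F_n$ containing $x$ and, for $n\ge1$, let $\tilde b_n(x)=\inf\{b_n(y): y\in\omega\}$, where $\omega$ is the atom of $\mathcal F_{n-1}$ containing $x$. For a real-valued martingale $F=(F_n)_{n\ge0}$ adapted to $\mathcal F$ put $\Delta F_n=F_n-F_{n-1}$ and $$\tilde I_\alpha[F]=\sum_{n=1}^\infty \tilde b_n^{\,\alpha}\,\Delta F_n,\qquad I^{\mathcal A}_\alpha[F]=\sum_{n=1}^\infty b_n^{\alpha}\,\Delta F_n .$$ (a) If $\|F\|_{L_p}:=\sup_n\|F_n\|_{L_p}<\infty$, then both series converge almost surely, their sums belong to $L_q$, and $$\|\tilde I_\alpha[F]\|_{L_q}\le C\|F\|_{L_p},\qquad \|I^{\mathcal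 A}_\alpha[F]\|_{L_q}\le C\|F\|_{L_p}.$$ (b) Consequently, assigning to $f\in L_p(\Omega,\Sigma,P)$ the sums $\tilde I_\alpha[F]$ and $I^{\mathcal A}_\alpha[F]$ for the martingale $F_n=\mathbb E(f\mid\mathcal F_n)$ defines bounded linear operators from $L_p$ to $L_q$ with norms at most $C$. -/

import Mathlib

open MeasureTheory Filter Topology
open scoped NNReal ENNReal

universe u

namespace MartingaleFracInt

variable {Ω : Type*}

/-- The atom of the `σ`-algebra `m` containing `x`: the intersection of all `m`-measurable sets
that contain `x`. -/
def atomAt (m : MeasurableSpace Ω) (x : Ω) : Set Ω :=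
  @measurableAtom Ω m x

/-- The set of atoms of the `σ`-algebra `m`. -/
def atoms (m : MeasurableSpace Ω) : Set (Set Ω) :=
  Set.range (atomAt m)

/-- The `σ`-algebra `m` has at most countably many atoms and is generated by them. -/
def CountablyAtomic (m : MeasurableSpace Ω) : Prop :=
  (atoms m).Countable ∧ m = MeasurableSpace.generateFrom (atoms m)

/-- `b_n (x)` is the probability of the atom of `ℱ n` containing `x`, that is,
`b_n = ∑ P(w) χ_w` with the sum taken over the atoms `w` of `ℱ n`. -/
noncomputable def b {m0 : MeasurableSpace Ω} (P : Measure Ω) (ℱ : Filtration ℕ m0)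
    (n : ℕ) (x : Ω) : ℝ :=
  P.real (atomAt (ℱ n) x)

/-- `b̃_n (x)`, for `n ≥ 1`, is the infimum of `b_n` over the atom of `ℱ (n - 1)` containing `x`.
(The value at `n = 0` is never used.) -/
noncomputable def bTilde {m0 : MeasurableSpace Ω} (P : Measure Ω) (ℱ : Filtration ℕ m0)
    (n : ℕ) (x : Ω) : ℝ :=
  sInf (b P ℱ n '' atomAt (ℱ (n - 1)) x)

/-- The partial sum `∑_{n = 1}^N c_n ^ α ΔF_n` at `x`, where `ΔF_n = F_n - F_{n-1}`. -/
noncomputable def partialSum (c : ℕ → Ω → ℝ) (α : ℝ) (F : ℕ → Ω → ℝ) (N : ℕ) (x : Ω) : ℝ :=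
  ∑ n ∈ Finset.Icc 1 N, c n x ^ α * (F n x - F (n - 1) x)

/-- The pointwise sum `∑_{n = 1}^∞ c_n ^ α ΔF_n`, as the limit of the partial sums. -/
noncomputable def seriesSum (c : ℕ → Ω → ℝ) (α : ℝ) (F : ℕ → Ω → ℝ) (x : Ω) : ℝ :=
  limUnder atTop fun N => partialSum c α F N x

/-- The martingale fractional integral `Ĩ_α[F] = ∑_{n ≥ 1} b̃_n ^ α ΔF_n`. -/
noncomputable def fracIntTilde {m0 : MeasurableSpace Ω} (P : Measure Ω) (ℱ : Filtration ℕ m0)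
    (α : ℝ) (F : ℕ → Ω → ℝ) : Ω → ℝ :=
  seriesSum (bTilde P ℱ) α F

/-- The fractional integral `I^A_α[F] = ∑_{n ≥ 1} b_n ^ α ΔF_n`. -/
noncomputable def fracIntA {m0 : MeasurableSpace Ω} (P : Measure Ω) (ℱ : Filtration ℕ m0)
    (α : ℝ) (F : ℕ → Ω → ℝ) : Ω → ℝ :=
  seriesSum (b P ℱ) α F

/-- The `L_p` norm of a martingale, `sup_n ‖F_n‖_{L_p}`. -/
noncomputable def martingaleNorm {m0 : MeasurableSpace Ω} (P : Measure Ω) (p : ℝ)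
    (F : ℕ → Ω → ℝ) : ℝ≥0∞ :=
  ⨆ n, eLpNorm (F n) (ENNReal.ofReal p) P

end MartingaleFracInt

/-! Both series are dominated by `∑ b_n ^ α |ΔF_n|`, because `0 ≤ b̃_n ≤ b_n`; no cancellation
between increments is needed. This sum satisfies a pointwise Hedberg inequality: up to `N` it is at
most a constant times `M ^ (p / q) * K ^ (1 - p / q)`, where `M` is the maximal average of `|F_N|`
and `K` is the `L_p` norm of the martingale. Taking `L_q` norms and applying Doob's inequality to
`M` gives the bound, uniformly in `N`; almost sure convergence and the bound on the sum follow.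

Along one trajectory the averages `G_n` of `|F_N|` are at most `min M (K * b_n ^ (-1 / p))`. Without
regularity `b_n` may drop slowly or abruptly, so the sum cannot be compared with a geometric series.
Instead each term is bounded by the drop of `b_n ^ α * G_n` plus a multiple of the drop of a bounded
increasing potential of `b_n` (`rpow_mul_increment_le`). These drops telescope
(`sum_rpow_mul_abs_sub_le`), so the number of steps does not matter. -/

namespace MartingaleFracInt

/-! ### Hedberg's inequality along a decreasing sequence of atoms. -/

section Hedberg

/-- A bounded antiderivative (up to constants) of `t ↦ min (M t ^ (α - 1)) (K t ^ (-1 - 1 / q))`,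
where the two branches meet at `t₀`. -/
noncomputable def hedbergPotential (α q M K t₀ t : ℝ) : ℝ :=
  M * (min t t₀) ^ α - α * q * K * (max t t₀) ^ (-(1 / q))

/-- Both sides are compared with `-α * log r` by means of `1 + x ≤ exp x`. -/
lemma one_sub_rpow_le {α q r : ℝ} (hα : 0 ≤ α) (hq : 0 < q) (hr : 0 < r) :
    1 - r ^ α ≤ α * q * (r ^ (-(1 / q)) - 1) := by
  rw [Real.rpow_def_of_pos hr, Real.rpow_def_of_pos hr]
  have h1 := Real.add_one_le_exp (Real.log r * α)
  have h2 := Real.add_one_le_exp (Real.log r * -(1 / q))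
  have h3 : α * q * (Real.log r * -(1 / q)) ≤ α * q * (Real.exp (Real.log r * -(1 / q)) - 1) := by
    gcongr
    linarith
  have h4 : α * q * (Real.log r * -(1 / q)) = -(Real.log r * α) := by field_simp
  linarith

variable {α p q M K t₀ a b : ℝ}

lemma rpow_sub_rpow_mul_le (hα : 0 ≤ α) (hq : 0 < q) (hpq : 1 / p - 1 / q = α) (hK : 0 ≤ K)
    (ha : 0 < a) (hb : 0 < b) :
    (b ^ α - a ^ α) * (K * b ^ (-(1 / p))) ≤
      α * q * K * (a ^ (-(1 / q)) - b ^ (-(1 / q))) := by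
  have h := one_sub_rpow_le hα hq (div_pos ha hb)
  rw [Real.div_rpow ha.le hb.le, Real.div_rpow ha.le hb.le] at h
  have hbα : 0 < b ^ α := Real.rpow_pos_of_pos hb _
  have hbq : 0 < b ^ (-(1 / q)) := Real.rpow_pos_of_pos hb _
  have e : b ^ (-(1 / q)) = b ^ α * b ^ (-(1 / p)) := by
    rw [← Real.rpow_add hb]; congr 1; linarith
  have h2 := mul_le_mul_of_nonneg_left h (mul_nonneg hK hbq.le)
  have e1 : K * b ^ (-(1 / q)) * (1 - a ^ α / b ^ α) =
      (b ^ α - a ^ α) * (K * b ^ (-(1 / p))) := by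
    rw [e]; field_simp
  have e2 : K * b ^ (-(1 / q)) * (α * q * (a ^ (-(1 / q)) / b ^ (-(1 / q)) - 1)) =
      α * q * K * (a ^ (-(1 / q)) - b ^ (-(1 / q))) := by
    field_simp
  linarith

/-- The interval is split at `t₀`. Below it the potential is exactly `M * t ^ α` up to a constant;
above it `rpow_sub_rpow_mul_le` applies. -/
lemma rpow_sub_rpow_mul_le_hedbergPotential_sub (hα : 0 ≤ α) (hq : 0 < q)
    (hpq : 1 / p - 1 / q = α) (hK : 0 ≤ K) (ht₀ : 0 < t₀) (ha : 0 < a) (hab : a ≤ b) :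
    (b ^ α - a ^ α) * min M (K * b ^ (-(1 / p))) ≤
      hedbergPotential α q M K t₀ b - hedbergPotential α q M K t₀ a := by
  have hb := ha.trans_le hab
  have hmono : ∀ {x y : ℝ}, 0 < x → x ≤ y → 0 ≤ y ^ α - x ^ α := fun hx hxy =>
    sub_nonneg.2 (Real.rpow_le_rpow hx.le hxy hα)
  unfold hedbergPotential
  rcases le_total b t₀ with h | h
  · have h' := hab.trans h
    rw [min_eq_left h, min_eq_left h', max_eq_right h, max_eq_right h']
    have := mul_le_mul_of_nonneg_left (min_le_left M (K * b ^ (-(1 / p)))) (hmono ha hab)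
    linarith
  rcases le_total t₀ a with h' | h'
  · rw [min_eq_right h, min_eq_right h', max_eq_left h, max_eq_left h']
    have := mul_le_mul_of_nonneg_left (min_le_right M (K * b ^ (-(1 / p)))) (hmono ha hab)
    have := rpow_sub_rpow_mul_le hα hq hpq hK ha hb
    linarith
  · rw [min_eq_right h, min_eq_left h', max_eq_left h, max_eq_right h']
    have h1 := mul_le_mul_of_nonneg_left (min_le_left M (K * b ^ (-(1 / p)))) (hmono ha h')
    have h2 := mul_le_mul_of_nonneg_left (min_le_right M (K * b ^ (-(1 / p)))) (hmono ht₀ h)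
    have := rpow_sub_rpow_mul_le hα hq hpq hK ht₀ hb
    linarith

lemma hedbergPotential_mono (hα : 0 ≤ α) (hq : 0 < q)
    (hpq : 1 / p - 1 / q = α) (hM : 0 ≤ M) (hK : 0 ≤ K) (ht₀ : 0 < t₀) (ha : 0 < a)
    (hab : a ≤ b) :
    hedbergPotential α q M K t₀ a ≤ hedbergPotential α q M K t₀ b := by
  have h := rpow_sub_rpow_mul_le_hedbergPotential_sub (M := M) hα hq hpq hK ht₀ ha hab
  have hb := ha.trans_le hab
  have : 0 ≤ (b ^ α - a ^ α) * min M (K * b ^ (-(1 / p))) :=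
    mul_nonneg (sub_nonneg.2 (Real.rpow_le_rpow ha.le hab hα))
      (le_min hM (mul_nonneg hK (Real.rpow_nonneg hb.le _)))
  linarith

/-- The bound is free of `a` and `b`, which makes the telescoped sum independent of its length. -/
lemma hedbergPotential_sub_le (hα : 0 ≤ α) (hq : 0 < q) (hM : 0 ≤ M) (hK : 0 ≤ K) (ht₀ : 0 < t₀)
    (ha : 0 < a) (hb : 0 < b) :
    hedbergPotential α q M K t₀ b - hedbergPotential α q M K t₀ a ≤
      M * t₀ ^ α + α * q * (K * t₀ ^ (-(1 / q))) := by
  unfold hedbergPotential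
  have h1 : M * (min b t₀) ^ α ≤ M * t₀ ^ α := by
    gcongr
    exact min_le_right _ _
  have h2 : (max a t₀) ^ (-(1 / q)) ≤ t₀ ^ (-(1 / q)) :=
    Real.rpow_le_rpow_of_nonpos ht₀ (le_max_right _ _) (by have := one_div_pos.2 hq; linarith)
  have h3 : α * q * K * (max a t₀) ^ (-(1 / q)) ≤ α * q * K * t₀ ^ (-(1 / q)) := by gcongr
  have h4 : 0 ≤ M * (min a t₀) ^ α := mul_nonneg hM (Real.rpow_nonneg (le_min ha.le ht₀.le) _)
  have h5 : 0 ≤ α * q * K * (max b t₀) ^ (-(1 / q)) := by positivity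
  linarith

/-- By concavity the graph of `y ^ α` lies above its chord on `[1, 2]`. -/
lemma sub_one_mul_le_rpow_sub_one {y : ℝ} (hα0 : 0 ≤ α) (hα1 : α ≤ 1) (h1 : 1 ≤ y) (h2 : y ≤ 2) :
    (y - 1) * (2 ^ α - 1) ≤ y ^ α - 1 := by
  have h := (Real.concaveOn_rpow hα0 hα1).2 (Set.mem_Ici.2 zero_le_one)
    (Set.mem_Ici.2 zero_le_two) (sub_nonneg.2 h2) (sub_nonneg.2 h1) (by ring)
  simp only [smul_eq_mul, Real.one_rpow, mul_one] at h
  rw [show 2 - y + (y - 1) * 2 = y by ring] at h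
  linarith

/-- One step of the telescoping bound behind Hedberg's inequality for martingales. -/
lemma rpow_mul_increment_le {G G' D : ℝ} (hα0 : 0 < α) (hα1 : α < 1) (hp : 1 < p) (hq : 0 < q)
    (hpq : 1 / p - 1 / q = α) (hM : 0 ≤ M) (hK : 0 ≤ K) (ht₀ : 0 < t₀) (ha : 0 < a)
    (hab : a ≤ b) (hG' : 0 ≤ G')
    (hGM : G ≤ M) (hGK : G ≤ K * a ^ (-(1 / p))) (hGM' : G' ≤ M) (hGK' : G' ≤ K * b ^ (-(1 / p)))
    (hD : D ≤ G + G') (haD : a * D ≤ b * G' - a * G + G' * (b - a)) :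
    a ^ α * D ≤ b ^ α * G' - a ^ α * G + 4 / (2 ^ α - 1) *
      (hedbergPotential α q M K t₀ b - hedbergPotential α q M K t₀ a) := by
  have hb := ha.trans_le hab
  have haα : 0 < a ^ α := Real.rpow_pos_of_pos ha _
  have hc : 0 < (2 : ℝ) ^ α - 1 := sub_pos.2 (Real.one_lt_rpow one_lt_two hα0)
  -- For a small drop, `haD` costs an error proportional to `b - a`, which the potential pays for by
  -- concavity. For a large drop the crude bound `hD` is enough, since the potential gains a fixed
  -- share of `a ^ α * G` already between `a` and `2 * a`.
  rcases le_or_gt b (2 * a) with h | h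
  · set y := b / a with hy
    have hby : b = a * y := by rw [hy]; field_simp
    have hy1 : 1 ≤ y := (one_le_div ha).2 hab
    have hy2 : y ≤ 2 := (div_le_iff₀ ha).2 h
    have hyα : b ^ α = a ^ α * y ^ α := by rw [hby, Real.mul_rpow ha.le (by linarith)]
    have hΨ := rpow_sub_rpow_mul_le_hedbergPotential_sub (M := M) hα0.le hq hpq hK ht₀ ha hab
    have hΨ' : a ^ α * (y ^ α - 1) * G' ≤
        hedbergPotential α q M K t₀ b - hedbergPotential α q M K t₀ a := by
      refine le_trans ?_ hΨ
      rw [hyα, show a ^ α * y ^ α - a ^ α = a ^ α * (y ^ α - 1) by ring]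
      have : 0 ≤ y ^ α - 1 := sub_nonneg.2 (Real.one_le_rpow hy1 hα0.le)
      gcongr
      exact le_min hGM' hGK'
    have hconc := sub_one_mul_le_rpow_sub_one hα0.le hα1.le hy1 hy2
    have hyα1 : 1 ≤ y ^ α := Real.one_le_rpow hy1 hα0.le
    have h1 : D ≤ y * G' - G + G' * (y - 1) := by
      rw [hby] at haD
      refine le_of_mul_le_mul_left ?_ ha
      linarith
    have h2 : a ^ α * D ≤ a ^ α * (y * G' - G + G' * (y - 1)) := by gcongr
    have h3 : a ^ α * ((y - 1) * G') ≤ 1 / (2 ^ α - 1) *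
        (hedbergPotential α q M K t₀ b - hedbergPotential α q M K t₀ a) := by
      rw [one_div_mul_eq_div, le_div_iff₀ hc]
      refine le_trans ?_ hΨ'
      rw [show a ^ α * ((y - 1) * G') * (2 ^ α - 1) = a ^ α * ((y - 1) * (2 ^ α - 1)) * G' by ring]
      gcongr
    have h4 : 0 ≤ a ^ α * ((y - 1) * G') := by
      have : 0 ≤ y - 1 := by linarith
      positivity
    have h5 : a ^ α * G' ≤ a ^ α * y ^ α * G' := by
      have := mul_le_mul_of_nonneg_left hyα1 (mul_nonneg haα.le hG')
      linarith
    rw [hyα, show (4 : ℝ) / (2 ^ α - 1) = 4 * (1 / (2 ^ α - 1)) by ring]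
    linarith
  · have h2a : 0 < 2 * a := by linarith
    have h1 := rpow_sub_rpow_mul_le_hedbergPotential_sub (M := M) hα0.le hq hpq hK ht₀ ha
      (show a ≤ 2 * a by linarith)
    have h2 := hedbergPotential_mono (M := M) hα0.le hq hpq hM hK ht₀ h2a h.le
    rw [Real.mul_rpow zero_le_two ha.le, Real.mul_rpow zero_le_two ha.le] at h1
    -- The bound on `G` is at scale `a`, the potential's at scale `2 * a`; the passage costs at most
    -- a factor 2.
    have hhalf : (1 : ℝ) / 2 ≤ 2 ^ (-(1 / p)) := by
      rw [show (1 : ℝ) / 2 = 2 ^ (-1 : ℝ) by rw [Real.rpow_neg_one]; norm_num]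
      apply Real.rpow_le_rpow_of_exponent_le one_le_two
      have : 1 / p ≤ 1 := (div_le_one (by linarith)).2 hp.le
      linarith
    have h3 : G / 2 ≤ min M (K * (2 ^ (-(1 / p)) * a ^ (-(1 / p)))) := by
      refine le_min (by linarith) ?_
      have : K * a ^ (-(1 / p)) * (1 / 2) ≤ K * a ^ (-(1 / p)) * 2 ^ (-(1 / p)) := by gcongr
      linarith
    have h4 : (2 ^ α - 1) * a ^ α * (G / 2) ≤
        hedbergPotential α q M K t₀ b - hedbergPotential α q M K t₀ a := by
      have : (2 ^ α - 1) * a ^ α * (G / 2) ≤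
        (2 ^ α - 1) * a ^ α * min M (K * (2 ^ (-(1 / p)) * a ^ (-(1 / p)))) := by gcongr
      linarith
    have h5 : 2 * (a ^ α * G) ≤ 4 / (2 ^ α - 1) *
        (hedbergPotential α q M K t₀ b - hedbergPotential α q M K t₀ a) := by
      rw [div_mul_eq_mul_div, le_div_iff₀ hc]
      linarith
    have h6 : a ^ α * D ≤ a ^ α * (G + G') := by gcongr
    have h7 : a ^ α * G' ≤ b ^ α * G' := by gcongr
    linarith

/-- The point `(K / M) ^ p` is where `M = K * t ^ (-1 / p)`; it balances the two terms of
`hedbergPotential_sub_le`. -/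
lemma hedberg_crossing (hp : 0 < p) (hq : 0 < q) (hpq : 1 / p - 1 / q = α)
    (hM : 0 < M) (hK : 0 < K) :
    M * ((K / M) ^ p) ^ α = M ^ (p / q) * K ^ (1 - p / q) ∧
      K * ((K / M) ^ p) ^ (-(1 / q)) = M ^ (p / q) * K ^ (1 - p / q) := by
  have e : p * α = 1 - p / q := by rw [← hpq]; field_simp
  constructor
  · rw [← Real.rpow_mul (by positivity), Real.div_rpow hK.le hM.le, e]
    rw [Real.rpow_sub hM, Real.rpow_one]
    field_simp
  · rw [← Real.rpow_mul (by positivity), show p * -(1 / q) = -(p / q) by ring,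
      Real.div_rpow hK.le hM.le, Real.rpow_neg hK.le, Real.rpow_neg hM.le, Real.rpow_sub hK,
      Real.rpow_one]
    field_simp

/-- Write `G = G ^ (p / q) * G ^ (1 - p / q)` and use one bound on each factor; the powers of `b`
cancel. This handles the boundary term of the telescoping. -/
lemma rpow_mul_le_of_le_of_le {G : ℝ} (hp : 0 < p) (hq : p < q) (hpq : 1 / p - 1 / q = α)
    (hG : 0 ≤ G) (hM : 0 ≤ M) (hK : 0 ≤ K) (hb : 0 < b) (hGM : G ≤ M)
    (hGK : G ≤ K * b ^ (-(1 / p))) :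
    b ^ α * G ≤ M ^ (p / q) * K ^ (1 - p / q) := by
  have hq0 : 0 < q := hp.trans hq
  have hθ0 : 0 ≤ p / q := by positivity
  have hθ1 : 0 ≤ 1 - p / q := sub_nonneg.2 ((div_le_one hq0).2 hq.le)
  have e : G = G ^ (p / q) * G ^ (1 - p / q) := by
    rw [← Real.rpow_add' hG (by simp)]; simp
  have h1 : G ^ (p / q) ≤ M ^ (p / q) := Real.rpow_le_rpow hG hGM hθ0
  have h2 : G ^ (1 - p / q) ≤ K ^ (1 - p / q) * b ^ (-α) := by
    refine (Real.rpow_le_rpow hG hGK hθ1).trans_eq ?_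
    rw [Real.mul_rpow hK (Real.rpow_nonneg hb.le _), ← Real.rpow_mul hb.le]
    congr 2
    rw [← hpq]; field_simp
  calc b ^ α * G = b ^ α * (G ^ (p / q) * G ^ (1 - p / q)) := by rw [← e]
    _ ≤ b ^ α * (M ^ (p / q) * (K ^ (1 - p / q) * b ^ (-α))) := by gcongr
    _ = M ^ (p / q) * K ^ (1 - p / q) * (b ^ α * b ^ (-α)) := by ring
    _ = _ := by rw [← Real.rpow_add hb]; simp

/-- The constant in the pointwise Hedberg-type inequality. -/
noncomputable def hedbergConst (α q : ℝ) : ℝ :=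
  1 + 4 / (2 ^ α - 1) * (1 + α * q)

lemma hedbergConst_nonneg (hα0 : 0 < α) (hq : 0 < q) : 0 ≤ hedbergConst α q := by
  have hc : 0 < (2 : ℝ) ^ α - 1 := sub_pos.2 (Real.one_lt_rpow one_lt_two hα0)
  unfold hedbergConst
  positivity

/-- Hedberg's inequality for one trajectory: here `b n` are the probabilities of a decreasing
sequence of atoms, `G n` are the averages of a nonnegative function over them, and `F n` the
averages of a function it dominates. -/
theorem sum_rpow_mul_abs_sub_le {b G F : ℕ → ℝ} {N : ℕ} (hα0 : 0 < α) (hα1 : α < 1) (hp : 1 < p)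
    (hq : p < q) (hpq : 1 / p - 1 / q = α) (hM : 0 ≤ M) (hK : 0 ≤ K)
    (hb : ∀ n ≤ N, 0 < b n) (hanti : ∀ n < N, b (n + 1) ≤ b n) (hG : ∀ n ≤ N, 0 ≤ G n)
    (hGM : ∀ n ≤ N, G n ≤ M) (hGK : ∀ n ≤ N, G n ≤ K * b n ^ (-(1 / p)))
    (hF : ∀ n ≤ N, |F n| ≤ G n)
    (hs : ∀ n < N, |b (n + 1) * F (n + 1) - b n * F n| ≤ b n * G n - b (n + 1) * G (n + 1)) :
    ∑ n ∈ Finset.Icc 1 N, b n ^ α * |F n - F (n - 1)| ≤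
      hedbergConst α q * (M ^ (p / q) * K ^ (1 - p / q)) := by
  have hp0 : 0 < p := by linarith
  have hq0 : 0 < q := by linarith
  have hRHS : 0 ≤ hedbergConst α q * (M ^ (p / q) * K ^ (1 - p / q)) :=
    mul_nonneg (hedbergConst_nonneg hα0 hq0) (by positivity)
  -- Here the crossing point would not be positive, but all `F n` vanish.
  by_cases hMK : M = 0 ∨ K = 0
  · have hG0 : ∀ n ≤ N, G n ≤ 0 := by
      intro n hn
      rcases hMK with h | h
      · exact (hGM n hn).trans_eq h
      · simpa [h] using hGK n hn
    have hF0 : ∀ n ≤ N, F n = 0 := fun n hn =>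
      abs_nonpos_iff.1 ((hF n hn).trans (hG0 n hn))
    refine le_trans (le_of_eq (Finset.sum_eq_zero fun n hn => ?_)) hRHS
    rw [Finset.mem_Icc] at hn
    rw [hF0 n hn.2, hF0 (n - 1) (by omega)]
    simp
  push Not at hMK
  have hM' : 0 < M := lt_of_le_of_ne hM hMK.1.symm
  have hK' : 0 < K := lt_of_le_of_ne hK hMK.2.symm
  obtain ⟨e1, e2⟩ := hedberg_crossing hp0 hq0 hpq hM' hK'
  set t₀ := (K / M) ^ p with ht
  have ht₀ : 0 < t₀ := by positivity
  set Ψ := hedbergPotential α q M K t₀ with hΨ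
  have hc : 0 < (2 : ℝ) ^ α - 1 := sub_pos.2 (Real.one_lt_rpow one_lt_two hα0)
  have key : ∀ n ≤ N, ∑ k ∈ Finset.Icc 1 n, b k ^ α * |F k - F (k - 1)| ≤
      b 0 ^ α * G 0 - b n ^ α * G n + 4 / (2 ^ α - 1) * (Ψ (b 0) - Ψ (b n)) := by
    intro n
    induction n with
    | zero => intro _; simp
    | succ n ih =>
      intro hn
      have hn' : n ≤ N := by omega
      rw [Finset.sum_Icc_succ_top (by omega), Nat.add_sub_cancel]
      have hbn := hb (n + 1) hn
      have hanti' := hanti n hn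
      have hD : |F (n + 1) - F n| ≤ G (n + 1) + G n :=
        (abs_sub _ _).trans (add_le_add (hF _ hn) (hF _ hn'))
      have haD : b (n + 1) * |F (n + 1) - F n| ≤
          b n * G n - b (n + 1) * G (n + 1) + G n * (b n - b (n + 1)) := by
        rw [← abs_of_pos hbn, ← abs_mul, abs_of_pos hbn]
        -- The change of the integral over the atom is separated from the change of its mass.
        rw [show b (n + 1) * (F (n + 1) - F n) =
          (b (n + 1) * F (n + 1) - b n * F n) + F n * (b n - b (n + 1)) by ring]
        refine (abs_add_le _ _).trans (add_le_add (hs n hn) ?_)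
        rw [abs_mul, abs_of_nonneg (sub_nonneg.2 hanti')]
        have := sub_nonneg.2 hanti'
        gcongr
        exact hF n hn'
      have hstep := rpow_mul_increment_le hα0 hα1 hp hq0 hpq hM hK ht₀ hbn hanti'
        (hG n hn') (hGM _ hn) (hGK _ hn) (hGM _ hn') (hGK _ hn') hD haD
      have := ih hn'
      linarith
  refine (key N le_rfl).trans ?_
  have h0 := rpow_mul_le_of_le_of_le hp0 hq hpq (hG 0 (Nat.zero_le _)) hM hK (hb 0 (Nat.zero_le _))
    (hGM 0 (Nat.zero_le _)) (hGK 0 (Nat.zero_le _))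
  have h1 : 0 ≤ b N ^ α * G N :=
    mul_nonneg (Real.rpow_nonneg (hb N le_rfl).le _) (hG N le_rfl)
  have h2 := hedbergPotential_sub_le hα0.le hq0 hM hK ht₀ (hb N le_rfl) (hb 0 (Nat.zero_le _))
  rw [e1, e2] at h2
  have h3 := mul_le_mul_of_nonneg_left h2 (show 0 ≤ 4 / ((2 : ℝ) ^ α - 1) by positivity)
  unfold hedbergConst
  linarith

end Hedberg

/-! ### Doob's maximal inequality in `L_p`. -/

section Doob

variable {Ω : Type*} {m0 : MeasurableSpace Ω} {P : Measure Ω}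

/-- A weak-type inequality of Doob's form implies the corresponding strong `L^p` inequality. -/
lemma lintegral_rpow_le_of_mul_meas_le [IsFiniteMeasure P] {f M : Ω → ℝ} {p : ℝ} (hp : 1 < p)
    (hf : Measurable f) (hM : Measurable M) (hf0 : 0 ≤ f) (hM0 : 0 ≤ M)
    (hweak : ∀ t : ℝ, 0 < t →
      ENNReal.ofReal t * P {x | t ≤ M x} ≤ ∫⁻ x in {x | t ≤ M x}, ENNReal.ofReal (f x) ∂P)
    (hfin : ∫⁻ x, ENNReal.ofReal (M x ^ p) ∂P ≠ ∞) :
    ∫⁻ x, ENNReal.ofReal (M x ^ p) ∂P ≤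
      ENNReal.ofReal (p / (p - 1)) ^ p * ∫⁻ x, ENNReal.ofReal (f x ^ p) ∂P := by
  have hp0 : 0 < p := by linarith
  have hp1 : 0 < p - 1 := by linarith
  set X := ∫⁻ x, ENNReal.ofReal (M x ^ p) ∂P with hX
  set A := ∫⁻ x, ENNReal.ofReal (f x ^ p) ∂P with hA
  set ν := P.withDensity fun x => ENNReal.ofReal (f x) with hν
  have hset : ∀ t : ℝ, MeasurableSet {x | t ≤ M x} := fun t => measurableSet_le measurable_const hM
  -- Layer cake for `P`, then the weak-type bound; `h2` reads the result as a layer cake for `f · P`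
  -- with exponent `p - 1`.
  have h1 : X ≤ ENNReal.ofReal p *
      ∫⁻ t in Set.Ioi 0, ν {x | t ≤ M x} * ENNReal.ofReal (t ^ (p - 1 - 1)) := by
    rw [hX, lintegral_rpow_eq_lintegral_meas_le_mul P (ae_of_all _ hM0) hM.aemeasurable hp0]
    gcongr 1
    refine setLIntegral_mono' measurableSet_Ioi fun t ht => ?_
    rw [hν, withDensity_apply _ (hset t)]
    have ht : (0 : ℝ) < t := ht
    rw [show p - 1 = 1 + (p - 1 - 1) by ring, Real.rpow_add ht, Real.rpow_one,
      ENNReal.ofReal_mul ht.le, ← mul_assoc, mul_comm (P _)]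
    rw [show 1 + (p - 1 - 1) - 1 = p - 1 - 1 by ring]
    gcongr
    exact hweak t ht
  have h2 : ENNReal.ofReal (p - 1) * X ≤
      ENNReal.ofReal p * ∫⁻ x, ENNReal.ofReal (f x) * ENNReal.ofReal (M x ^ (p - 1)) ∂P := by
    have := lintegral_rpow_eq_lintegral_meas_le_mul ν (ae_of_all _ hM0) hM.aemeasurable hp1
    rw [hν, lintegral_withDensity_eq_lintegral_mul _ hf.ennreal_ofReal
      (hM.pow_const _).ennreal_ofReal] at this
    simp only [Pi.mul_apply] at this
    rw [this, mul_left_comm]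
    gcongr
  have hconj : p.HolderConjugate (p / (p - 1)) := Real.HolderConjugate.conjExponent hp
  have h3 : ∫⁻ x, ENNReal.ofReal (f x) * ENNReal.ofReal (M x ^ (p - 1)) ∂P ≤
      A ^ (1 / p) * X ^ (1 - 1 / p) := by
    refine (ENNReal.lintegral_mul_le_Lp_mul_Lq P hconj hf.ennreal_ofReal.aemeasurable
      (hM.pow_const _).ennreal_ofReal.aemeasurable).trans_eq ?_
    congr 1
    · congr 1
      refine lintegral_congr fun x => ?_
      rw [ENNReal.ofReal_rpow_of_nonneg (hf0 x) hp0.le]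
    · rw [show 1 / (p / (p - 1)) = 1 - 1 / p by field_simp]
      congr 1
      refine lintegral_congr fun x => ?_
      rw [ENNReal.ofReal_rpow_of_nonneg (Real.rpow_nonneg (hM0 x) _) (by positivity),
        ← Real.rpow_mul (hM0 x), show (p - 1) * (p / (p - 1)) = p by field_simp]
  rcases eq_or_ne X 0 with h0 | h0
  · rw [h0]; exact zero_le
  -- Hölder's bound is divided by `X ^ (1 - 1 / p)`, which requires `X` to be nonzero and finite.
  have h4 : ENNReal.ofReal (p - 1) * X ^ (1 / p) ≤ ENNReal.ofReal p * A ^ (1 / p) := by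
    have hXp0 : X ^ (1 - 1 / p) ≠ 0 := by
      simp [ENNReal.rpow_eq_zero_iff, h0, hfin]
    have hXpt : X ^ (1 - 1 / p) ≠ ∞ := by
      simp [ENNReal.rpow_eq_top_iff, h0, hfin]
    rw [← ENNReal.mul_le_mul_iff_left hXp0 hXpt, mul_assoc, mul_assoc,
      ← ENNReal.rpow_add _ _ h0 hfin]
    simp only [add_sub_cancel, ENNReal.rpow_one]
    exact h2.trans (by gcongr)
  have h5 : X ^ (1 / p) ≤ ENNReal.ofReal (p / (p - 1)) * A ^ (1 / p) := by
    rw [ENNReal.ofReal_div_of_pos hp1, ENNReal.mul_div_right_comm.symm]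
    rw [ENNReal.le_div_iff_mul_le (by simp [hp]) (by simp), mul_comm]
    exact h4
  have h6 := ENNReal.rpow_le_rpow h5 hp0.le
  rwa [ENNReal.mul_rpow_of_nonneg _ _ hp0.le, ← ENNReal.rpow_mul, ← ENNReal.rpow_mul,
    one_div_mul_cancel hp0.ne', ENNReal.rpow_one, ENNReal.rpow_one] at h6

lemma lintegral_ofReal_rpow_eq_eLpNorm_rpow {f : Ω → ℝ} (hf0 : 0 ≤ f) {p : ℝ} (hp : 0 < p) :
    ∫⁻ x, ENNReal.ofReal (f x ^ p) ∂P = eLpNorm f (ENNReal.ofReal p) P ^ p := by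
  rw [eLpNorm_eq_lintegral_rpow_enorm_toReal (by simpa using hp) (by simp),
    ENNReal.toReal_ofReal hp.le, ← ENNReal.rpow_mul, one_div_mul_cancel hp.ne', ENNReal.rpow_one]
  refine lintegral_congr fun x => ?_
  rw [Real.enorm_eq_ofReal (hf0 x), ENNReal.ofReal_rpow_of_nonneg (hf0 x) hp.le]

/-- **Doob's `L^p` inequality** for a nonnegative submartingale. -/
theorem eLpNorm_sup'_le_of_submartingale [IsFiniteMeasure P] {ℱ : Filtration ℕ m0} {f : ℕ → Ω → ℝ}
    {p : ℝ} (hp : 1 < p) (hf : Submartingale f ℱ P) (hf0 : 0 ≤ f)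
    (hfp : ∀ n, MemLp (f n) (ENNReal.ofReal p) P) (N : ℕ) :
    eLpNorm (fun x => (Finset.range (N + 1)).sup' Finset.nonempty_range_add_one fun k => f k x)
      (ENNReal.ofReal p) P ≤
      ENNReal.ofReal (p / (p - 1)) * eLpNorm (f N) (ENNReal.ofReal p) P := by
  have hp0 : 0 < p := by linarith
  set M := fun x => (Finset.range (N + 1)).sup' Finset.nonempty_range_add_one fun k => f k x with hM
  have hfm : ∀ n, Measurable (f n) := fun n => ((hf.stronglyMeasurable n).mono (ℱ.le n)).measurable
  have hMm : Measurable M := by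
    have := Finset.measurable_sup' (s := Finset.range (N + 1)) Finset.nonempty_range_add_one
      (f := f) fun n _ => hfm n
    convert this using 1
    ext x
    simp [hM, Finset.sup'_apply]
  have hM0 : 0 ≤ M := fun x =>
    (hf0 0 x).trans (Finset.le_sup' (fun k => f k x) (Finset.mem_range.2 (Nat.succ_pos N)))
  have hMle : ∀ x, M x ≤ ∑ k ∈ Finset.range (N + 1), f k x := fun x =>
    Finset.sup'_le _ _ fun k hk => Finset.single_le_sum (f := fun k => f k x)
      (fun i _ => hf0 i x) hk
  have hMp : MemLp M (ENNReal.ofReal p) P := by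
    refine (memLp_finsetSum (Finset.range (N + 1)) fun k _ => hfp k).mono hMm.aestronglyMeasurable
      (ae_of_all _ fun x => ?_)
    rw [Real.norm_of_nonneg (hM0 x)]
    exact (hMle x).trans (le_abs_self _)
  have hpow := lintegral_rpow_le_of_mul_meas_le (P := P) hp (hfm N) hMm (hf0 N) hM0 ?_ ?_
  · rw [lintegral_ofReal_rpow_eq_eLpNorm_rpow hM0 hp0,
      lintegral_ofReal_rpow_eq_eLpNorm_rpow (hf0 N) hp0,
      ← ENNReal.mul_rpow_of_nonneg _ _ hp0.le] at hpow
    exact (ENNReal.rpow_le_rpow_iff hp0).1 hpow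
  · intro t ht
    have h := maximal_ineq hf hf0 (ε := t.toNNReal) N
    rw [Real.coe_toNNReal t ht.le] at h
    rwa [ofReal_integral_eq_lintegral_ofReal (hf.integrable N).integrableOn
      (ae_of_all _ (hf0 N))] at h
  · rw [lintegral_ofReal_rpow_eq_eLpNorm_rpow hM0 hp0]
    exact ENNReal.rpow_ne_top_of_nonneg hp0.le hMp.eLpNorm_ne_top

end Doob

/-! ### Countably atomic `σ`-algebras. -/

section Atoms

variable {Ω : Type*} {m m' : MeasurableSpace Ω} {x y : Ω}

lemma mem_atomAt_self (m : MeasurableSpace Ω) (x : Ω) : x ∈ atomAt m x :=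
  @mem_measurableAtom_self Ω m x

lemma atomAt_eq_of_mem (h : y ∈ atomAt m x) : atomAt m y = atomAt m x :=
  @measurableAtom_eq_of_mem Ω m y x h

lemma atomAt_anti (h : m ≤ m') (x : Ω) : atomAt m' x ⊆ atomAt m x := by
  intro y hy
  simp only [atomAt, measurableAtom, Set.mem_iInter] at hy ⊢
  exact fun s hx hs => hy s hx (h s hs)

lemma CountablyAtomic.measurableSet_atomAt (hm : CountablyAtomic m) (x : Ω) :
    MeasurableSet[m] (atomAt m x) := by
  have h : MeasurableSet[MeasurableSpace.generateFrom (atoms m)] (atomAt m x) :=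
    MeasurableSpace.measurableSet_generateFrom ⟨x, rfl⟩
  rwa [← hm.2] at h

lemma eq_of_mem_atomAt {f : Ω → ℝ} (hf : Measurable[m] f) (h : y ∈ atomAt m x) : f y = f x :=
  @mem_of_mem_measurableAtom Ω m x y h _ (hf (measurableSet_singleton (f x))) rfl

/-- Each preimage is a union of atoms, and there are only countably many of them. -/
lemma CountablyAtomic.measurable_of_forall_eq (hm : CountablyAtomic m) {f : Ω → ℝ}
    (hf : ∀ x, ∀ y ∈ atomAt m x, f y = f x) : Measurable[m] f := by
  intro S _
  have h : f ⁻¹' S = ⋃₀ {a ∈ atoms m | a ⊆ f ⁻¹' S} := by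
    ext x
    refine ⟨fun hx => ⟨atomAt m x, ⟨⟨x, rfl⟩, fun y hy => ?_⟩, mem_atomAt_self m x⟩, ?_⟩
    · rw [Set.mem_preimage, hf x y hy]; exact hx
    · rintro ⟨a, ⟨_, ha⟩, hxa⟩
      exact ha hxa
  rw [h]
  refine MeasurableSet.sUnion (hm.1.mono fun a ha => ha.1) ?_
  rintro a ⟨⟨x, rfl⟩, _⟩
  exact hm.measurableSet_atomAt x

lemma CountablyAtomic.ae_measureReal_atomAt_pos {m0 : MeasurableSpace Ω} {P : Measure Ω}
    [IsFiniteMeasure P] (hm : CountablyAtomic m) : ∀ᵐ x ∂P, 0 < P.real (atomAt m x) := by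
  have h : P (⋃₀ {a ∈ atoms m | P a = 0}) = 0 :=
    (measure_sUnion_null_iff (hm.1.mono fun a ha => ha.1)).2 fun a ha => ha.2
  refine measure_mono_null (fun x hx => ?_) h
  refine ⟨atomAt m x, ⟨⟨x, rfl⟩, ?_⟩, mem_atomAt_self m x⟩
  have hx' : ¬ 0 < P.real (atomAt m x) := hx
  rcases eq_or_ne (P (atomAt m x)) 0 with h0 | h0
  · exact h0
  · exact absurd (ENNReal.toReal_pos h0 (measure_ne_top _ _)) hx'

end Atoms

/-! ### The weights `b_n` and `b̃_n`. -/

section Weights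

variable {Ω : Type*} {m0 : MeasurableSpace Ω} {P : Measure Ω} {ℱ : Filtration ℕ m0}

lemma b_nonneg (n : ℕ) (x : Ω) : 0 ≤ b P ℱ n x := measureReal_nonneg

lemma b_succ_le [IsFiniteMeasure P] (n : ℕ) (x : Ω) : b P ℱ (n + 1) x ≤ b P ℱ n x :=
  measureReal_mono (atomAt_anti (ℱ.mono n.le_succ) x)

lemma bTilde_nonneg (n : ℕ) (x : Ω) : 0 ≤ bTilde P ℱ n x :=
  Real.sInf_nonneg (by rintro _ ⟨y, _, rfl⟩; exact b_nonneg n y)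

lemma bTilde_le_b (n : ℕ) (x : Ω) : bTilde P ℱ n x ≤ b P ℱ n x :=
  csInf_le ⟨0, by rintro _ ⟨y, _, rfl⟩; exact b_nonneg n y⟩ ⟨x, mem_atomAt_self _ x, rfl⟩

lemma measurable_b (hℱ : ∀ n, CountablyAtomic (ℱ n)) (n : ℕ) : Measurable (b P ℱ n) :=
  ((hℱ n).measurable_of_forall_eq fun x y hy => by
    unfold b; rw [atomAt_eq_of_mem hy]).mono (ℱ.le n) le_rfl

lemma measurable_bTilde (hℱ : ∀ n, CountablyAtomic (ℱ n)) (n : ℕ) :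
    Measurable (bTilde P ℱ n) :=
  ((hℱ (n - 1)).measurable_of_forall_eq fun x y hy => by
    unfold bTilde; rw [atomAt_eq_of_mem hy]).mono (ℱ.le (n - 1)) le_rfl

lemma ae_b_pos [IsFiniteMeasure P] (hℱ : ∀ n, CountablyAtomic (ℱ n)) :
    ∀ᵐ x ∂P, ∀ n, 0 < b P ℱ n x :=
  ae_all_iff.2 fun n => (hℱ n).ae_measureReal_atomAt_pos

lemma measurable_partialSum {c F : ℕ → Ω → ℝ} {α : ℝ} (hc : ∀ n, Measurable (c n))
    (hF : ∀ n, Measurable (F n)) (N : ℕ) : Measurable (partialSum c α F N) :=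
  Finset.measurable_sum _ fun n _ => ((hc n).pow_const α).mul ((hF n).sub (hF (n - 1)))

end Weights

/-! ### Averages over atoms. -/

section Averages

variable {Ω : Type*} {m0 : MeasurableSpace Ω} {P : Measure Ω} {ℱ : Filtration ℕ m0}

lemma b_mul_eq_setIntegral {F : ℕ → Ω → ℝ} [IsFiniteMeasure P]
    (hℱ : ∀ n, CountablyAtomic (ℱ n)) (hF : Martingale F ℱ P) {n N : ℕ} (hn : n ≤ N) (x : Ω) :
    b P ℱ n x * F n x = ∫ y in atomAt (ℱ n) x, F N y ∂P := by
  have hms := (hℱ n).measurableSet_atomAt x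
  rw [← hF.setIntegral_eq hn hms, setIntegral_congr_fun (g := fun _ => F n x) (ℱ.le n _ hms)
    fun y hy => eq_of_mem_atomAt (hF.stronglyMeasurable n).measurable hy]
  simp [b]

lemma b_mul_condExp_eq_setIntegral {g : Ω → ℝ} [IsFiniteMeasure P]
    (hℱ : ∀ n, CountablyAtomic (ℱ n)) (hg : Integrable g P) (n : ℕ) (x : Ω) :
    b P ℱ n x * (P[g | ℱ n]) x = ∫ y in atomAt (ℱ n) x, g y ∂P := by
  have hms := (hℱ n).measurableSet_atomAt x
  rw [← setIntegral_condExp (ℱ.le n) hg hms,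
    setIntegral_congr_fun (g := fun _ => (P[g | ℱ n]) x) (ℱ.le n _ hms)
    fun y hy => eq_of_mem_atomAt stronglyMeasurable_condExp.measurable hy]
  simp [b]

lemma setIntegral_norm_le_eLpNorm_mul [IsFiniteMeasure P] {f : Ω → ℝ} {p : ℝ} (hp : 1 < p)
    (hf : MemLp f (ENNReal.ofReal p) P) (s : Set Ω) :
    ∫ y in s, |f y| ∂P ≤ (eLpNorm f (ENNReal.ofReal p) P).toReal * P.real s ^ (1 - 1 / p) := by
  have hp0 : 0 < p := by linarith
  have h1 := eLpNorm_le_eLpNorm_mul_rpow_measure_univ (μ := P.restrict s) (f := f) (p := 1)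
    (q := ENNReal.ofReal p) (by rw [← ENNReal.ofReal_one]; exact ENNReal.ofReal_le_ofReal hp.le)
    hf.1.restrict
  rw [ENNReal.toReal_one, ENNReal.toReal_ofReal hp0.le, div_one, Measure.restrict_apply_univ] at h1
  have h2 : eLpNorm f 1 (P.restrict s) ≤ eLpNorm f (ENNReal.ofReal p) P * P s ^ (1 - 1 / p) :=
    h1.trans (by gcongr; exact Measure.restrict_le_self)
  have he : 0 ≤ 1 - 1 / p := sub_nonneg.2 ((div_le_one hp0).2 hp.le)
  have h3 := ENNReal.toReal_mono
    (ENNReal.mul_ne_top hf.eLpNorm_ne_top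
      (ENNReal.rpow_ne_top_of_nonneg he (measure_ne_top P s))) h2
  rw [ENNReal.toReal_mul, ← ENNReal.toReal_rpow] at h3
  refine le_trans (le_of_eq ?_) h3
  rw [eLpNorm_one_eq_lintegral_enorm, ← integral_norm_eq_lintegral_enorm hf.1.restrict]
  rfl

end Averages

/-! ### Bounds and convergence for the fractional integrals. -/

section FracInt

variable {Ω : Type*} {m0 : MeasurableSpace Ω} {P : Measure Ω} {ℱ : Filtration ℕ m0}
  {F : ℕ → Ω → ℝ} {c : ℕ → Ω → ℝ} {α p q : ℝ}

lemma eLpNorm_le_martingaleNorm (n : ℕ) :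
    eLpNorm (F n) (ENNReal.ofReal p) P ≤ martingaleNorm P p F :=
  le_iSup (fun n => eLpNorm (F n) (ENNReal.ofReal p) P) n

lemma memLp_of_martingaleNorm_lt_top (hF : Martingale F ℱ P) (h : martingaleNorm P p F < ∞)
    (n : ℕ) : MemLp (F n) (ENNReal.ofReal p) P :=
  ⟨((hF.stronglyMeasurable n).mono (ℱ.le n)).aestronglyMeasurable,
    (eLpNorm_le_martingaleNorm n).trans_lt h⟩

/-- The averages `E(|F_N| | ℱ_n)`, made nonnegative everywhere. -/
noncomputable def absAverage (P : Measure Ω) (ℱ : Filtration ℕ m0) (g : Ω → ℝ) (n : ℕ) (x : Ω) :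
    ℝ :=
  (P[fun y => |g y| | ℱ n] x)⁺

/-- The maximal function `max_{n ≤ N} E(|g| | ℱ_n)`. -/
noncomputable def maxAverage (P : Measure Ω) (ℱ : Filtration ℕ m0) (g : Ω → ℝ) (N : ℕ) (x : Ω) :
    ℝ :=
  (Finset.range (N + 1)).sup' Finset.nonempty_range_add_one fun k => absAverage P ℱ g k x

lemma absAverage_nonneg (g : Ω → ℝ) : 0 ≤ absAverage P ℱ g := fun _ _ => posPart_nonneg _

lemma absAverage_le_maxAverage (g : Ω → ℝ) {n N : ℕ} (hn : n ≤ N) (x : Ω) :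
    absAverage P ℱ g n x ≤ maxAverage P ℱ g N x :=
  Finset.le_sup' (fun k => absAverage P ℱ g k x) (Finset.mem_range.2 (Nat.lt_succ_of_le hn))

lemma maxAverage_nonneg (g : Ω → ℝ) (N : ℕ) (x : Ω) : 0 ≤ maxAverage P ℱ g N x :=
  (absAverage_nonneg g 0 x).trans (absAverage_le_maxAverage g (Nat.zero_le N) x)

lemma submartingale_absAverage [IsFiniteMeasure P] (g : Ω → ℝ) :
    Submartingale (absAverage P ℱ g) ℱ P :=
  (martingale_condExp (fun y => |g y|) ℱ P).submartingale.pos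

/-- The positive part changes nothing on atoms of positive mass, and on null atoms both sides
vanish; hence the identity holds at every point. -/
lemma b_mul_absAverage [IsFiniteMeasure P] (hℱ : ∀ n, CountablyAtomic (ℱ n)) {g : Ω → ℝ}
    (hg : Integrable g P) (n : ℕ) (x : Ω) :
    b P ℱ n x * absAverage P ℱ g n x = ∫ y in atomAt (ℱ n) x, |g y| ∂P := by
  have h := b_mul_condExp_eq_setIntegral hℱ hg.abs n x
  have h0 : 0 ≤ ∫ y in atomAt (ℱ n) x, |g y| ∂P := integral_nonneg fun _ => abs_nonneg _
  rcases (b_nonneg (P := P) (ℱ := ℱ) n x).eq_or_lt with hb | hb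
  · rw [← h, ← hb]; simp
  · rw [← h] at h0
    rw [absAverage, posPart_eq_self.2 (nonneg_of_mul_nonneg_right h0 hb), ← h]

lemma eLpNorm_absAverage_le [IsFiniteMeasure P] (hp : 1 ≤ p) (g : Ω → ℝ) (n : ℕ) :
    eLpNorm (absAverage P ℱ g n) (ENNReal.ofReal p) P ≤ eLpNorm g (ENNReal.ofReal p) P := by
  refine (eLpNorm_mono_ae (g := P[fun y => |g y| | ℱ n]) (ae_of_all _ fun x => ?_)).trans
    ((eLpNorm_condExp_le_eLpNorm _ ?_).trans_eq (eLpNorm_norm g))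
  · rw [Real.norm_of_nonneg (absAverage_nonneg g n x), Real.norm_eq_abs]
    exact sup_le (le_abs_self _) (abs_nonneg _)
  · rw [← ENNReal.ofReal_one]; exact ENNReal.ofReal_le_ofReal hp

lemma eLpNorm_maxAverage_le [IsFiniteMeasure P] (hp : 1 < p) {g : Ω → ℝ}
    (hg : MemLp g (ENNReal.ofReal p) P) (N : ℕ) :
    eLpNorm (maxAverage P ℱ g N) (ENNReal.ofReal p) P ≤
      ENNReal.ofReal (p / (p - 1)) * eLpNorm g (ENNReal.ofReal p) P := by
  have hsub := submartingale_absAverage (P := P) (ℱ := ℱ) g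
  refine (eLpNorm_sup'_le_of_submartingale hp hsub (absAverage_nonneg g) (fun n => ?_) N).trans ?_
  · exact ⟨((hsub.stronglyMeasurable n).mono (ℱ.le n)).aestronglyMeasurable,
      (eLpNorm_absAverage_le hp.le g n).trans_lt hg.2⟩
  · gcongr
    exact eLpNorm_absAverage_le hp.le g N

/-- The pointwise Hedberg-type inequality for martingales. -/
lemma sum_b_rpow_mul_abs_le [IsProbabilityMeasure P] (hα0 : 0 < α) (hα1 : α < 1) (hp : 1 < p)
    (hpq : p < q) (hα : 1 / p - 1 / q = α) (hℱ : ∀ n, CountablyAtomic (ℱ n))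
    (hF : Martingale F ℱ P) (hFp : martingaleNorm P p F < ∞) (N : ℕ) {x : Ω}
    (hx : ∀ n, 0 < b P ℱ n x) :
    ∑ n ∈ Finset.Icc 1 N, b P ℱ n x ^ α * |F n x - F (n - 1) x| ≤
      hedbergConst α q * (maxAverage P ℱ (F N) N x ^ (p / q) *
        (martingaleNorm P p F).toReal ^ (1 - p / q)) := by
  have hp0 : 0 < p := by linarith
  have hmem := memLp_of_martingaleNorm_lt_top hF hFp N
  have hint := hF.integrable N
  have hGs := b_mul_absAverage hℱ hint (x := x)
  refine sum_rpow_mul_abs_sub_le (b := fun n => b P ℱ n x) (F := fun n => F n x)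
    (G := fun n => absAverage P ℱ (F N) n x)
    hα0 hα1 hp hpq hα (maxAverage_nonneg _ _ _) ENNReal.toReal_nonneg
    (fun n _ => hx n) (fun n _ => b_succ_le n x) (fun n _ => absAverage_nonneg _ n x)
    (fun n hn => absAverage_le_maxAverage _ hn x) (fun n hn => ?_) (fun n hn => ?_)
    (fun n hn => ?_)
  · refine le_of_mul_le_mul_left ?_ (hx n)
    rw [hGs]
    refine (setIntegral_norm_le_eLpNorm_mul hp hmem _).trans ?_
    have hK : (eLpNorm (F N) (ENNReal.ofReal p) P).toReal ≤ (martingaleNorm P p F).toReal :=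
      ENNReal.toReal_mono hFp.ne (eLpNorm_le_martingaleNorm N)
    have e : P.real (atomAt (ℱ n) x) ^ (1 - 1 / p) = b P ℱ n x * b P ℱ n x ^ (-(1 / p)) := by
      change b P ℱ n x ^ (1 - 1 / p) = _
      rw [sub_eq_add_neg, Real.rpow_add (hx n), Real.rpow_one]
    rw [e]
    have hb := hx n
    calc _ ≤ (martingaleNorm P p F).toReal * (b P ℱ n x * b P ℱ n x ^ (-(1 / p))) := by gcongr
      _ = _ := by ring
  · refine le_of_mul_le_mul_left ?_ (hx n)
    rw [hGs, ← abs_of_pos (hx n), ← abs_mul, b_mul_eq_setIntegral hℱ hF hn]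
    exact abs_integral_le_integral_abs
  -- Both differences are integrals, of `F N` and of `|F N|`, over the part of the atom that is
  -- discarded.
  · have hsub : atomAt (ℱ (n + 1)) x ⊆ atomAt (ℱ n) x := atomAt_anti (ℱ.mono n.le_succ) x
    have hms := ℱ.le _ _ ((hℱ (n + 1)).measurableSet_atomAt x)
    rw [hGs, hGs, b_mul_eq_setIntegral hℱ hF hn, b_mul_eq_setIntegral hℱ hF hn.le, abs_sub_comm,
      ← setIntegral_sdiff hms hint.integrableOn hsub,
      ← setIntegral_sdiff hms hint.abs.integrableOn hsub]
    exact abs_integral_le_integral_abs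

/-- The constant in the `L_p → L_q` bounds. -/
noncomputable def fracIntConst (α p q : ℝ) : ℝ≥0 :=
  (hedbergConst α q * (p / (p - 1)) ^ (p / q)).toNNReal

lemma eLpNorm_sum_b_rpow_mul_abs_le [IsProbabilityMeasure P] (hα0 : 0 < α) (hα1 : α < 1)
    (hp : 1 < p) (hpq : p < q) (hα : 1 / p - 1 / q = α) (hℱ : ∀ n, CountablyAtomic (ℱ n))
    (hF : Martingale F ℱ P) (hFp : martingaleNorm P p F < ∞) (N : ℕ) :
    eLpNorm (fun x => ∑ n ∈ Finset.Icc 1 N, b P ℱ n x ^ α * |F n x - F (n - 1) x|)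
      (ENNReal.ofReal q) P ≤ fracIntConst α p q * martingaleNorm P p F := by
  have hp0 : 0 < p := by linarith
  have hq0 : 0 < q := by linarith
  have hθ : 0 < p / q := by positivity
  have hθ1 : 0 ≤ 1 - p / q := sub_nonneg.2 ((div_le_one hq0).2 hpq.le)
  have hp' : 0 ≤ p / (p - 1) := div_nonneg hp0.le (by linarith)
  have hH := hedbergConst_nonneg hα0 hq0
  set K := martingaleNorm P p F with hK
  set M := maxAverage P ℱ (F N) N with hM
  have h1 : eLpNorm (fun x => ∑ n ∈ Finset.Icc 1 N, b P ℱ n x ^ α * |F n x - F (n - 1) x|)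
      (ENNReal.ofReal q) P ≤
      eLpNorm (fun x => (hedbergConst α q * K.toReal ^ (1 - p / q)) • ‖M x‖ ^ (p / q))
        (ENNReal.ofReal q) P := by
    refine eLpNorm_mono_ae ?_
    filter_upwards [ae_b_pos (P := P) hℱ] with x hx
    rw [Real.norm_of_nonneg (Finset.sum_nonneg fun n _ =>
      mul_nonneg (Real.rpow_nonneg (b_nonneg n x) _) (abs_nonneg _))]
    refine (sum_b_rpow_mul_abs_le hα0 hα1 hp hpq hα hℱ hF hFp N hx).trans ?_
    refine le_trans (le_of_eq ?_) (le_abs_self _)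
    rw [smul_eq_mul, Real.norm_of_nonneg (maxAverage_nonneg _ _ _)]
    ring
  refine h1.trans ?_
  have h2 : eLpNorm M (ENNReal.ofReal p) P ≤ ENNReal.ofReal (p / (p - 1)) * K :=
    (eLpNorm_maxAverage_le hp (memLp_of_martingaleNorm_lt_top hF hFp N) N).trans (by
      gcongr; exact eLpNorm_le_martingaleNorm N)
  have hKpow : ENNReal.ofReal (K.toReal ^ (1 - p / q)) = K ^ (1 - p / q) := by
    rw [← ENNReal.ofReal_rpow_of_nonneg ENNReal.toReal_nonneg hθ1, ENNReal.ofReal_toReal hFp.ne]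
  change eLpNorm ((hedbergConst α q * K.toReal ^ (1 - p / q)) • fun x => ‖M x‖ ^ (p / q)) _ _ ≤ _
  -- The `L_q` norm of `M ^ (p / q)` is the `L_p` norm of `M` to the power `p / q`, which Doob's
  -- inequality controls.
  rw [eLpNorm_const_smul, eLpNorm_norm_rpow _ hθ, ← ENNReal.ofReal_mul hq0.le,
    mul_div_cancel₀ p hq0.ne', Real.enorm_eq_ofReal (by positivity), ENNReal.ofReal_mul hH, hKpow]
  calc _ ≤ ENNReal.ofReal (hedbergConst α q) * K ^ (1 - p / q) *
        (ENNReal.ofReal (p / (p - 1)) * K) ^ (p / q) := by gcongr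
    _ = ENNReal.ofReal (hedbergConst α q) * ENNReal.ofReal (p / (p - 1)) ^ (p / q) *
        (K ^ (1 - p / q) * K ^ (p / q)) := by
      rw [ENNReal.mul_rpow_of_nonneg _ _ hθ.le]; ring
    _ = _ := by
      rw [← ENNReal.rpow_add_of_nonneg _ _ hθ1 hθ.le, sub_add_cancel, ENNReal.rpow_one,
        ENNReal.ofReal_rpow_of_nonneg hp' hθ.le, ← ENNReal.ofReal_mul hH]
      rfl

lemma measurable_of_martingale (hF : Martingale F ℱ P) (n : ℕ) : Measurable (F n) :=
  ((hF.stronglyMeasurable n).mono (ℱ.le n)).measurable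

/-- The uniform `L_q` bound makes the liminf of the partial sums finite almost everywhere; since
they increase, the liminf is their supremum. -/
lemma ae_summable_b_rpow_mul_abs [IsProbabilityMeasure P] (hα0 : 0 < α) (hα1 : α < 1)
    (hp : 1 < p) (hpq : p < q) (hα : 1 / p - 1 / q = α) (hℱ : ∀ n, CountablyAtomic (ℱ n))
    (hF : Martingale F ℱ P) (hFp : martingaleNorm P p F < ∞) :
    ∀ᵐ x ∂P, Summable fun n => b P ℱ (n + 1) x ^ α * |F (n + 1) x - F n x| := by
  have hq0 : 0 < q := by linarith
  have hnn : ∀ n x, 0 ≤ b P ℱ n x ^ α * |F n x - F (n - 1) x| := fun n x =>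
    mul_nonneg (Real.rpow_nonneg (b_nonneg n x) _) (abs_nonneg _)
  have hbdd := ae_bdd_liminf_atTop_of_eLpNorm_bdd (μ := P) (p := ENNReal.ofReal q)
    (f := fun N x => ∑ n ∈ Finset.Icc 1 N, b P ℱ n x ^ α * |F n x - F (n - 1) x|)
    (R := (fracIntConst α p q * (martingaleNorm P p F).toNNReal)) (by simpa using hq0)
    (fun N => Finset.measurable_sum _ fun n _ => ((measurable_b hℱ n).pow_const α).mul
      ((measurable_of_martingale hF n).sub (measurable_of_martingale hF (n - 1))).abs)
    (fun N => by
      rw [ENNReal.coe_mul, ENNReal.coe_toNNReal hFp.ne]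
      exact eLpNorm_sum_b_rpow_mul_abs_le hα0 hα1 hp hpq hα hℱ hF hFp N)
  filter_upwards [hbdd] with x hx
  set A : ℕ → ℝ := fun N => ∑ n ∈ Finset.Icc 1 N, b P ℱ n x ^ α * |F n x - F (n - 1) x| with hA
  have hA0 : ∀ N, 0 ≤ A N := fun N => Finset.sum_nonneg fun n _ => hnn n x
  have hmono : Monotone fun N => ‖A N‖ₑ := fun N N' h => by
    simp only [Real.enorm_eq_ofReal (hA0 _)]
    exact ENNReal.ofReal_le_ofReal (Finset.sum_le_sum_of_subset_of_nonneg
      (Finset.Icc_subset_Icc_right h) fun n _ _ => hnn n x)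
  rw [(tendsto_atTop_iSup hmono).liminf_eq] at hx
  have hsum : ∀ N, ∑ n ∈ Finset.range N, b P ℱ (n + 1) x ^ α * |F (n + 1) x - F n x| = A N := by
    intro N
    induction N with
    | zero => simp [hA]
    | succ N ih =>
      rw [Finset.sum_range_succ, ih, hA]
      simp only
      rw [Finset.sum_Icc_succ_top (by omega), Nat.add_sub_cancel]
  refine summable_of_sum_range_le (c := (⨆ N, ‖A N‖ₑ).toReal) (fun n => hnn (n + 1) x) fun N => ?_
  rw [hsum, ← ENNReal.ofReal_le_iff_le_toReal hx.ne, ← Real.enorm_eq_ofReal (hA0 N)]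
  exact le_iSup (fun N => ‖A N‖ₑ) N

lemma partialSum_eq_sum_range (N : ℕ) (x : Ω) :
    partialSum c α F N x = ∑ n ∈ Finset.range N, c (n + 1) x ^ α * (F (n + 1) x - F n x) := by
  unfold partialSum
  induction N with
  | zero => simp
  | succ N ih => rw [Finset.sum_range_succ, ← ih, Finset.sum_Icc_succ_top (by omega),
      Nat.add_sub_cancel]

theorem ae_tendsto_partialSum [IsProbabilityMeasure P] (hα0 : 0 < α) (hα1 : α < 1)
    (hp : 1 < p) (hpq : p < q) (hα : 1 / p - 1 / q = α) (hℱ : ∀ n, CountablyAtomic (ℱ n))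
    (hc0 : ∀ n x, 0 ≤ c n x) (hcb : ∀ n x, c n x ≤ b P ℱ n x)
    (hF : Martingale F ℱ P) (hFp : martingaleNorm P p F < ∞) :
    ∀ᵐ x ∂P, Tendsto (fun N => partialSum c α F N x) atTop (𝓝 (seriesSum c α F x)) := by
  filter_upwards [ae_summable_b_rpow_mul_abs hα0 hα1 hp hpq hα hℱ hF hFp] with x hx
  have hs : Summable fun n => c (n + 1) x ^ α * (F (n + 1) x - F n x) := by
    refine Summable.of_norm_bounded hx fun n => ?_
    rw [norm_mul, Real.norm_of_nonneg (Real.rpow_nonneg (hc0 _ _) _), Real.norm_eq_abs]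
    gcongr
    · exact hc0 _ _
    · exact hcb _ _
  refine tendsto_nhds_limUnder ⟨_, hs.hasSum.tendsto_sum_nat.congr fun N => ?_⟩
  rw [partialSum_eq_sum_range]

/-- Fatou's lemma carries the uniform bound on partial sums to the limit. -/
theorem memLp_seriesSum [IsProbabilityMeasure P] (hα0 : 0 < α) (hα1 : α < 1)
    (hp : 1 < p) (hpq : p < q) (hα : 1 / p - 1 / q = α) (hℱ : ∀ n, CountablyAtomic (ℱ n))
    (hc0 : ∀ n x, 0 ≤ c n x) (hcb : ∀ n x, c n x ≤ b P ℱ n x) (hcm : ∀ n, Measurable (c n))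
    (hF : Martingale F ℱ P) (hFp : martingaleNorm P p F < ∞) :
    MemLp (seriesSum c α F) (ENNReal.ofReal q) P ∧
      eLpNorm (seriesSum c α F) (ENNReal.ofReal q) P ≤
        fracIntConst α p q * martingaleNorm P p F := by
  have hlim := ae_tendsto_partialSum hα0 hα1 hp hpq hα hℱ hc0 hcb hF hFp
  have hm := measurable_partialSum (α := α) hcm (measurable_of_martingale hF)
  have hN : ∀ N, eLpNorm (partialSum c α F N) (ENNReal.ofReal q) P ≤
      fracIntConst α p q * martingaleNorm P p F := fun N => by
    refine le_trans (eLpNorm_mono_ae (ae_of_all _ fun x => ?_))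
      (eLpNorm_sum_b_rpow_mul_abs_le hα0 hα1 hp hpq hα hℱ hF hFp N)
    refine (norm_sum_le _ _).trans (le_trans (Finset.sum_le_sum fun n _ => ?_) (le_abs_self _))
    rw [norm_mul, Real.norm_of_nonneg (Real.rpow_nonneg (hc0 _ _) _), Real.norm_eq_abs]
    gcongr
    · exact hc0 _ _
    · exact hcb _ _
  have hle : eLpNorm (seriesSum c α F) (ENNReal.ofReal q) P ≤
      fracIntConst α p q * martingaleNorm P p F :=
    (Lp.eLpNorm_lim_le_liminf_eLpNorm (fun N => (hm N).aestronglyMeasurable) _ hlim).trans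
      ((liminf_le_liminf (Eventually.of_forall hN)).trans_eq (liminf_const _))
  exact ⟨⟨(aemeasurable_of_tendsto_metrizable_ae atTop (fun N => (hm N).aemeasurable)
    hlim).aestronglyMeasurable, hle.trans_lt (ENNReal.mul_lt_top ENNReal.coe_lt_top hFp)⟩, hle⟩

lemma martingaleNorm_condExp_le (hp : 1 ≤ p) (f : Ω → ℝ) :
    martingaleNorm P p (fun n => P[f | ℱ n]) ≤ eLpNorm f (ENNReal.ofReal p) P :=
  iSup_le fun n => eLpNorm_condExp_le_eLpNorm f (by
    rw [← ENNReal.ofReal_one]; exact ENNReal.ofReal_le_ofReal hp)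

/-- The operator `L_p → L_q` obtained by applying the series with weights `c` to the martingale
`E(f | ℱ_n)`. -/
theorem exists_linearMap_eq_seriesSum [IsProbabilityMeasure P] (hα0 : 0 < α) (hα1 : α < 1)
    (hp : 1 < p) (hpq : p < q) (hα : 1 / p - 1 / q = α) (hℱ : ∀ n, CountablyAtomic (ℱ n))
    (hc0 : ∀ n x, 0 ≤ c n x) (hcb : ∀ n x, c n x ≤ b P ℱ n x) (hcm : ∀ n, Measurable (c n)) :
    ∃ T : Lp ℝ (ENNReal.ofReal p) P →ₗ[ℝ] Lp ℝ (ENNReal.ofReal q) P,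
      ∀ f : Lp ℝ (ENNReal.ofReal p) P,
        T f =ᵐ[P] seriesSum c α (fun n => P[f | ℱ n]) ∧
        ‖T f‖ ≤ fracIntConst α p q * ‖f‖ := by
  have hp1 : (1 : ℝ≥0∞) ≤ ENNReal.ofReal p := by
    rw [← ENNReal.ofReal_one]; exact ENNReal.ofReal_le_ofReal hp.le
  have hint : ∀ f : Lp ℝ (ENNReal.ofReal p) P, Integrable f P := fun f =>
    (Lp.memLp f).integrable hp1
  have hmart : ∀ f : Lp ℝ (ENNReal.ofReal p) P, Martingale (fun n => P[f | ℱ n]) ℱ P := fun f =>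
    martingale_condExp f ℱ P
  have hnorm : ∀ f : Lp ℝ (ENNReal.ofReal p) P,
      martingaleNorm P p (fun n => P[f | ℱ n]) < ∞ := fun f =>
    (martingaleNorm_condExp_le hp.le f).trans_lt (Lp.eLpNorm_lt_top f)
  have hlim := fun f => ae_tendsto_partialSum hα0 hα1 hp hpq hα hℱ hc0 hcb (hmart f) (hnorm f)
  have hmem := fun f => memLp_seriesSum hα0 hα1 hp hpq hα hℱ hc0 hcb hcm (hmart f) (hnorm f)
  refine ⟨{ toFun := fun f => (hmem f).1.toLp _, map_add' := fun f g => ?_,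
            map_smul' := fun r f => ?_ }, fun f => ⟨(hmem f).1.coeFn_toLp, ?_⟩⟩
  · rw [← MemLp.toLp_add, MemLp.toLp_eq_toLp_iff]
    have hadd : ∀ᵐ x ∂P, ∀ n, (P[⇑(f + g) | ℱ n]) x = (P[f | ℱ n]) x + (P[g | ℱ n]) x :=
      ae_all_iff.2 fun n => (condExp_congr_ae (Lp.coeFn_add f g)).trans
        (condExp_add (hint f) (hint g) (ℱ n))
    -- `limUnder` is additive only where the limits exist, so convergence for `f` and `g` is needed
    -- here.
    filter_upwards [hadd, hlim f, hlim g] with x hx hf hg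
    refine ((hf.add hg).congr fun N => ?_).limUnder_eq
    simp only [partialSum, hx, ← Finset.sum_add_distrib]
    exact Finset.sum_congr rfl fun n _ => by ring
  · rw [RingHom.id_apply, ← MemLp.toLp_const_smul, MemLp.toLp_eq_toLp_iff]
    have hsmul : ∀ᵐ x ∂P, ∀ n, (P[⇑(r • f) | ℱ n]) x = r * (P[f | ℱ n]) x :=
      ae_all_iff.2 fun n => (condExp_congr_ae (Lp.coeFn_smul r f)).trans
        (condExp_smul r f (ℱ n))
    filter_upwards [hsmul, hlim f] with x hx hf
    refine ((hf.const_mul r).congr fun N => ?_).limUnder_eq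
    simp only [partialSum, hx, Finset.mul_sum]
    exact Finset.sum_congr rfl fun n _ => by ring
  · change ‖(hmem f).1.toLp _‖ ≤ _
    rw [Lp.norm_toLp, Lp.norm_def, ← ENNReal.coe_toReal, ← ENNReal.toReal_mul]
    exact ENNReal.toReal_mono (ENNReal.mul_ne_top ENNReal.coe_ne_top (Lp.eLpNorm_ne_top f))
      ((hmem f).2.trans (by gcongr; exact martingaleNorm_condExp_le hp.le f))

end FracInt

end MartingaleFracInt

theorem theorem1 (α p q : ℝ) (hα0 : 0 < α) (hα1 : α < 1) (hp : 1 < p) (hpq : p < q)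
    (hα : 1 / p - 1 / q = α) :
    ∃ C : ℝ≥0, ∀ (Ω : Type u) (m0 : MeasurableSpace Ω) (P : Measure Ω) (_ : IsProbabilityMeasure P)
      (ℱ : Filtration ℕ m0), (∀ n, MartingaleFracInt.CountablyAtomic (ℱ n)) →
      -- martingales bounded in `L_p`
      (∀ F : ℕ → Ω → ℝ, Martingale F ℱ P → MartingaleFracInt.martingaleNorm P p F < ∞ →
        ((∀ᵐ x ∂P, Tendsto
            (fun N => MartingaleFracInt.partialSum (MartingaleFracInt.bTilde P ℱ) α F N x)
            atTop (𝓝 (MartingaleFracInt.fracIntTilde P ℱ α F x))) ∧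
          MemLp (MartingaleFracInt.fracIntTilde P ℱ α F) (ENNReal.ofReal q) P ∧
          eLpNorm (MartingaleFracInt.fracIntTilde P ℱ α F) (ENNReal.ofReal q) P ≤
            C * MartingaleFracInt.martingaleNorm P p F) ∧
        ((∀ᵐ x ∂P, Tendsto
            (fun N => MartingaleFracInt.partialSum (MartingaleFracInt.b P ℱ) α F N x)
            atTop (𝓝 (MartingaleFracInt.fracIntA P ℱ α F x))) ∧
          MemLp (MartingaleFracInt.fracIntA P ℱ α F) (ENNReal.ofReal q) P ∧
          eLpNorm (MartingaleFracInt.fracIntA P ℱ α F) (ENNReal.ofReal q) P ≤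
            C * MartingaleFracInt.martingaleNorm P p F)) ∧
      -- the induced continuous linear operators on functions, `F_n = E(f | ℱ_n)`
      (∃ T S : Lp ℝ (ENNReal.ofReal p) P →ₗ[ℝ] Lp ℝ (ENNReal.ofReal q) P,
        ∀ f : Lp ℝ (ENNReal.ofReal p) P,
          (T f =ᵐ[P] MartingaleFracInt.fracIntTilde P ℱ α (fun n => P[f | ℱ n])) ∧
          ‖T f‖ ≤ C * ‖f‖ ∧
          (S f =ᵐ[P] MartingaleFracInt.fracIntA P ℱ α (fun n => P[f | ℱ n])) ∧
          ‖S f‖ ≤ C * ‖f‖) := by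
  refine ⟨MartingaleFracInt.fracIntConst α p q, fun Ω m0 P _ ℱ hℱ => ⟨fun F hF hFp => ?_, ?_⟩⟩
  · open MartingaleFracInt in
    exact ⟨⟨ae_tendsto_partialSum hα0 hα1 hp hpq hα hℱ bTilde_nonneg bTilde_le_b hF hFp,
        memLp_seriesSum hα0 hα1 hp hpq hα hℱ bTilde_nonneg bTilde_le_b (measurable_bTilde hℱ)
          hF hFp⟩,
      ⟨ae_tendsto_partialSum hα0 hα1 hp hpq hα hℱ b_nonneg (fun _ _ => le_rfl) hF hFp,
        memLp_seriesSum hα0 hα1 hp hpq hα hℱ b_nonneg (fun _ _ => le_rfl) (measurable_b hℱ)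
          hF hFp⟩⟩
  · open MartingaleFracInt in
    obtain ⟨T, hT⟩ := exists_linearMap_eq_seriesSum hα0 hα1 hp hpq hα hℱ bTilde_nonneg
      bTilde_le_b (measurable_bTilde (P := P) hℱ)
    open MartingaleFracInt in
    obtain ⟨S, hS⟩ := exists_linearMap_eq_seriesSum hα0 hα1 hp hpq hα hℱ b_nonneg
      (fun _ _ => le_rfl) (measurable_b (P := P) hℱ)
    exact ⟨T, S, fun f => ⟨(hT f).1, (hT f).2, (hS f).1, (hS f).2⟩⟩
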